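/- Let $0<s\le 1$, $0<\gamma\le 1$, let $N$ be a positive integer with $N>2s$, let $\Omega\subset\mathbb R^N$ be a bounded domain with $C^2$ boundary, and let $\delta(x)=\operatorname{dist}(x,\mathbb R^N\setminus\Omega)$ and $D_\Omega=\{(x,x):x\in\Omega\}$. Let $L^1(\Omega,\delta^\gamma)$ be the space of functions $u$ on $\Omega$ with $\int_\Omega|u|\,\delta^\gamma\,dx<\infty$, and let $\mathcal M(\Omega,\delta^\gamma)$ be the space of signed Radon measures $\mu$ on $\Omega$ with $\int_\Omega\delta^\gamma\,d|\mu|<\infty$. A sequence $\mu_n$ in $\mathcal M(\Omega,\delta^\gamma)$ is said to converge weakly to $\mu$ in $\mathcal M(\Omega,\delta^\gamma)$ if $\int_\Omega\zeta\,d\mu_n\to\int_\Omega\zeta\,d\mu$ for every $\zeta=\delta^\gamma h$ with $h\in C(\overline\Omega)$. Let $\mathbb L:\operatorname{dom}(\mathbb L)\subset L^2(\Omega)\to L^2(\Omega)$ be a linear operator and let $G^\Omega:(\Omega\times\Omega)\setminus D_\Omega\to(0,\infty)$; for functions $f$ and measures $\mu$ on $\Omega$ write $$\mathbb G^\Omega[f](x)=\int_\Omega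 G^\Omega(x,y)f(y)\,dy,\qquad \mathbb G^\Omega[\mu](x)=\int_\Omega G^\Omega(x,y)\,d\mu(y).$$ Assume: (G1) for every $f\in C_c^\infty(\Omega)$ one has $\mathbb G^\Omega[f]\in\operatorname{dom}(\mathbb L)$ and $\mathbb L[\mathbb G^\Omega[f]]=f$ in $L^2(\Omega)$; (G2) $G^\Omega$ is Borel measurable and symmetric, and there are constants $c_1,c_2>0$ such that for all $x,y\in\Omega$ with $x\ne y$, $$c_1\,k(x,y)\le G^\Omega(x,y)\le c_2\,k(x,y),\qquad k(x,y)=\frac1{|x-y|^{N-2s}}\Big(\frac{\delta(x)}{|x-y|}\wedge1\Big)^{\gamma}\Big(\frac{\delta(y)}{|x-y|}\wedge1\Big)^{\gamma};$$ (G3) $G^\Omega$ is jointly continuous on $(\Omega\times\Omega)\setminus D_\Omega$; (G4) for all $x_0\in\Omega$ and $z_0\in\partial\Omega$ the limit $M^\Omega(x_0,z_0)=\lim_{\Omega\times\Omega\ni(x,y)\to(x_0,z_0)}G^\Omega(x,y)/\delta(y)^\gamma$ exists in $[0,\infty)$, and $M^\Omega$ is continuous on $\Omega\times\partial\Omega$.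 Let $\mu_n,\mu\in\mathcal M(\Omega,\delta^\gamma)$ $(n\in\mathbb N)$ be such that $\mu_n$ converges weakly to $\mu$ in $\mathcal M(\Omega,\delta^\gamma)$. Then the integrals defining $\mathbb G^\Omega[\mu_n](x)$ and $\mathbb G^\Omega[\mu](x)$ converge absolutely for almost every $x\in\Omega$, the functions $\mathbb G^\Omega[\mu_n]$ and $\mathbb G^\Omega[\mu]$ belong to $L^1(\Omega,\delta^\gamma)$, and $$\mathbb G^\Omega[\mu_n]\to\mathbb G^\Omega[\mu]\quad\text{in }L^1(\Omega,\delta^\gamma)\text{ as }n\to\infty.$$ -/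

import Mathlib

open MeasureTheory Set Filter Topology
open scoped ContDiff ENNReal

noncomputable section

namespace GreenStability

/-- The Euclidean space `ℝ^N`. -/
abbrev Space (N : ℕ) := EuclideanSpace ℝ (Fin N)

variable {N : ℕ}

/-- A bounded domain (nonempty, open, connected) with `C²` boundary: near each boundary point `Ω`
is the negativity set of a `C²` function without critical points. -/
structure IsBoundedC2Domain (Ω : Set (Space N)) : Prop where
  isOpen : IsOpen Ω
  isConnected : IsConnected Ω
  isBounded : Bornology.IsBounded Ω
  boundary : ∀ z ∈ frontier Ω, ∃ U : Set (Space N), IsOpen U ∧ z ∈ U ∧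
    ∃ ρ : Space N → ℝ, ContDiffOn ℝ 2 ρ U ∧ (∀ x ∈ U, fderiv ℝ ρ x ≠ 0) ∧
      Ω ∩ U = {x ∈ U | ρ x < 0}

/-- `δ(x)`, the distance from `x` to `ℝ^N \ Ω`. -/
def bdist (Ω : Set (Space N)) (x : Space N) : ℝ := Metric.infDist x Ωᶜ

/-- The measure `δ^α dx` on `Ω`. The space `L^q(Ω, δ^α)` is `L^q` with respect to it. -/
def weightedVolume (Ω : Set (Space N)) (α : ℝ) : Measure (Space N) :=
  (volume.restrict Ω).withDensity fun x => ENNReal.ofReal (bdist Ω x ^ α)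

/-- A signed Radon measure on `Ω`, given by its Jordan decomposition: two mutually singular
positive Borel measures carried by `Ω` and finite on compact subsets of `Ω`.
Neither of them needs to be finite. -/
structure SignedRadonMeasure (Ω : Set (Space N)) where
  /-- the positive part `μ⁺` -/
  pos : Measure (Space N)
  /-- the negative part `μ⁻` -/
  neg : Measure (Space N)
  mutuallySingular : pos ⟂ₘ neg
  pos_compl : pos Ωᶜ = 0
  neg_compl : neg Ωᶜ = 0
  pos_lt_top : ∀ K ⊆ Ω, IsCompact K → pos K < ⊤
  neg_lt_top : ∀ K ⊆ Ω, IsCompact K → neg K < ⊤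

namespace SignedRadonMeasure

variable {Ω : Set (Space N)}

/-- The total variation `|μ| = μ⁺ + μ⁻`. -/
def totalVariation (μ : SignedRadonMeasure Ω) : Measure (Space N) := μ.pos + μ.neg

/-- `∫ φ dμ = ∫ φ dμ⁺ - ∫ φ dμ⁻`. -/
def integral (μ : SignedRadonMeasure Ω) (φ : Space N → ℝ) : ℝ :=
  (∫ x, φ x ∂μ.pos) - ∫ x, φ x ∂μ.neg

/-- `μ ∈ 𝓜(Ω, δ^α)`, that is, `∫ δ^α d|μ| < ∞`. -/
def MemWeighted (μ : SignedRadonMeasure Ω) (α : ℝ) : Prop :=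
  ∫⁻ x, ENNReal.ofReal (bdist Ω x ^ α) ∂μ.totalVariation < ⊤

end SignedRadonMeasure

/-- Weak convergence in `𝓜(Ω, δ^α)`: `∫ ζ dμₙ → ∫ ζ dμ` for every test function `ζ = δ^α h` with
`h` continuous on the closure of `Ω`. -/
def WeaklyConverges {Ω : Set (Space N)} (α : ℝ) (μ : ℕ → SignedRadonMeasure Ω)
    (μlim : SignedRadonMeasure Ω) : Prop :=
  ∀ h : Space N → ℝ, ContinuousOn h (closure Ω) →
    Tendsto (fun n => (μ n).integral fun x => bdist Ω x ^ α * h x) atTop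
      (𝓝 (μlim.integral fun x => bdist Ω x ^ α * h x))

/-- The space `C_c^∞(Ω)` of test functions. -/
def IsTestFunction (Ω : Set (Space N)) (f : Space N → ℝ) : Prop :=
  ContDiff ℝ ∞ f ∧ HasCompactSupport f ∧ tsupport f ⊆ Ω

/-- The Green operator on functions, `𝔾[f](x) = ∫_Ω G(x, y) f(y) dy`. -/
def greenFun (Ω : Set (Space N)) (G : Space N → Space N → ℝ) (f : Space N → ℝ) (x : Space N) : ℝ :=
  ∫ y in Ω, G x y * f y

/-- The Green operator on measures, `𝔾[μ](x) = ∫_Ω G(x, y) dμ(y)`. -/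
def greenMeas {Ω : Set (Space N)} (G : Space N → Space N → ℝ) (μ : SignedRadonMeasure Ω)
    (x : Space N) : ℝ :=
  μ.integral fun y => G x y

/-- `𝔾` is a right inverse of the (unbounded) operator `L` of `L²(Ω)` on test functions:
for `f ∈ C_c^∞(Ω)` one has `𝔾[f] ∈ dom L` and `L (𝔾[f]) = f` in `L²(Ω)`. -/
def IsGreenOperatorOf (Ω : Set (Space N))
    (L : Lp ℝ 2 (volume.restrict Ω) →ₗ.[ℝ] Lp ℝ 2 (volume.restrict Ω))
    (G : Space N → Space N → ℝ) : Prop :=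
  ∀ f : Space N → ℝ, IsTestFunction Ω f →
    ∃ u : L.domain, (u : Lp ℝ 2 (volume.restrict Ω)) =ᵐ[volume.restrict Ω] greenFun Ω G f ∧
      L u =ᵐ[volume.restrict Ω] f

/-- The comparison function
`|x-y|^{-(N-2s)} (δ(x)/|x-y| ∧ 1)^γ (δ(y)/|x-y| ∧ 1)^γ`. -/
def greenProfile (Ω : Set (Space N)) (s γ : ℝ) (x y : Space N) : ℝ :=
  1 / dist x y ^ ((N : ℝ) - 2 * s) * (min (bdist Ω x / dist x y) 1) ^ γ *
    (min (bdist Ω y / dist x y) 1) ^ γ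

/-- The kernel `G` on `(Ω × Ω) \ D_Ω` (its values elsewhere are irrelevant) is positive, Borel
measurable, symmetric, and comparable to the profile above. -/
structure IsGreenKernel (Ω : Set (Space N)) (s γ : ℝ) (G : Space N → Space N → ℝ) : Prop where
  measurable : Measurable (Ω.offDiag.domRestrict (Function.uncurry G))
  pos : ∀ x ∈ Ω, ∀ y ∈ Ω, x ≠ y → 0 < G x y
  symm : ∀ x ∈ Ω, ∀ y ∈ Ω, x ≠ y → G x y = G y x
  estimate : ∃ c₁ > 0, ∃ c₂ > 0, ∀ x ∈ Ω, ∀ y ∈ Ω, x ≠ y →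
    c₁ * greenProfile Ω s γ x y ≤ G x y ∧ G x y ≤ c₂ * greenProfile Ω s γ x y

/-- The Martin kernel `M(x₀, z₀) = lim G(x, y) / δ(y)^γ`, as `(x, y) ∈ Ω × Ω` tends to
`(x₀, z₀) ∈ Ω × ∂Ω`, exists and is a continuous function `Ω × ∂Ω → [0, ∞)`. -/
def HasContinuousMartinKernel (Ω : Set (Space N)) (γ : ℝ) (G : Space N → Space N → ℝ) : Prop :=
  ∃ M : Space N → Space N → ℝ,
    (∀ x₀ ∈ Ω, ∀ z₀ ∈ frontier Ω, 0 ≤ M x₀ z₀ ∧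
      Tendsto (fun p : Space N × Space N => G p.1 p.2 / bdist Ω p.2 ^ γ)
        (𝓝[Ω ×ˢ Ω] (x₀, z₀)) (𝓝 (M x₀ z₀))) ∧
    ContinuousOn (Function.uncurry M) (Ω ×ˢ frontier Ω)

/-- `𝔾[μ]` is a well-defined element of `L^1(Ω, δ^α)`: the defining integral converges absolutely
for almost every `x ∈ Ω`, and the resulting function is in `L^1(Ω, δ^α)`. -/
def GreenMemL1 {Ω : Set (Space N)} (α : ℝ) (G : Space N → Space N → ℝ)
    (μ : SignedRadonMeasure Ω) : Prop :=
  (∀ᵐ x ∂volume.restrict Ω, Integrable (fun y => G x y) μ.totalVariation) ∧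
    MemLp (greenMeas G μ) 1 (weightedVolume Ω α)

end GreenStability

end

/-!
Put `K(x, y) = δ(x)^γ G(x, y) / δ(y)^γ`, so that the weighted `L¹` norm of `𝔾[μₙ] - 𝔾[μ]` is the
unweighted one of `∫ K(x, y) d(δ^γ (μₙ - μ))(y)`. Since `δ(x) ≤ δ(y) + |x - y|`, the upper Green
function estimate gives `|K(x, y)| ≤ C |x - y|^{-(N - 2s)}`, a singularity integrable in `x`
uniformly in `y`. Weak convergence and the uniform boundedness principle bound the total masses of
`δ^γ μₙ`. By Fubini, the part of `K` near the diagonal therefore contributes to the `L¹` norm an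
amount small uniformly in `n`. Away from the diagonal `K(x, ·)` extends continuously to the closure
of `Ω`, by the continuity of `G` and the existence of the boundary limits, so it is an admissible
test function; the corresponding integrals converge to zero pointwise and boundedly in `x`, hence
in `L¹`.
-/

namespace GreenStability

open scoped BoundedContinuousFunction

section SignedIntegral

variable {X Y : Type*} [MeasurableSpace X] [MeasurableSpace Y]

/-- The integral `∫ f d(p - q)` against the signed measure `p - q`. Keeping the two positive
measures apart allows both of them to be infinite. -/
noncomputable def signedIntegral (p q : Measure X) (f : X → ℝ) : ℝ :=
  ∫ x, f x ∂p - ∫ x, f x ∂q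

theorem enorm_signedIntegral_le (p q : Measure X) (f : X → ℝ) :
    ‖signedIntegral p q f‖ₑ ≤ ∫⁻ x, ‖f x‖ₑ ∂(p + q) := by
  rw [lintegral_add_measure]
  exact enorm_sub_le.trans
    (add_le_add (enorm_integral_le_lintegral_enorm f) (enorm_integral_le_lintegral_enorm f))

theorem signedIntegral_sub {p q : Measure X} {f g : X → ℝ} (hf : Integrable f (p + q))
    (hg : Integrable g (p + q)) :
    signedIntegral p q (fun x => f x - g x) = signedIntegral p q f - signedIntegral p q g := by
  simp only [signedIntegral, integral_sub hf.left_of_add_measure hg.left_of_add_measure,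
    integral_sub hf.right_of_add_measure hg.right_of_add_measure]
  ring

theorem signedIntegral_add_swap {p q p' q' : Measure X} {f : X → ℝ} (hf : Integrable f (p + q))
    (hf' : Integrable f (p' + q')) :
    signedIntegral (p + q') (q + p') f = signedIntegral p q f - signedIntegral p' q' f := by
  simp only [signedIntegral,
    integral_add_measure hf.left_of_add_measure hf'.right_of_add_measure,
    integral_add_measure hf.right_of_add_measure hf'.left_of_add_measure]
  ring

theorem measurable_signedIntegral {p q : Measure Y} [SFinite p] [SFinite q] {K : X → Y → ℝ}
    (hK : Measurable (Function.uncurry K)) : Measurable fun x => signedIntegral p q (K x) :=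
  hK.stronglyMeasurable.integral_prod_right.measurable.sub
    hK.stronglyMeasurable.integral_prod_right.measurable

end SignedIntegral

section TotalMass

variable {X : Type*} [TopologicalSpace X] [MeasurableSpace X]

/-- The functional `h ↦ ∫ h d(p - q)` on bounded continuous functions. -/
noncomputable def signedIntegralCLM [OpensMeasurableSpace X] (p q : Measure X)
    [IsFiniteMeasure p] [IsFiniteMeasure q] : (X →ᵇ ℝ) →L[ℝ] ℝ :=
  LinearMap.mkContinuous
    { toFun := fun h => signedIntegral p q h
      map_add' := fun f g => by
        simp only [signedIntegral, BoundedContinuousFunction.coe_add, Pi.add_apply,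
          integral_add (f.integrable p) (g.integrable p),
          integral_add (f.integrable q) (g.integrable q)]
        ring
      map_smul' := fun c f => by
        simp only [signedIntegral, BoundedContinuousFunction.coe_smul, smul_eq_mul,
          RingHom.id_apply, integral_const_mul]
        ring }
    (p.real univ + q.real univ) fun h =>
      calc ‖signedIntegral p q h‖ ≤ ‖∫ x, h x ∂p‖ + ‖∫ x, h x ∂q‖ := norm_sub_le _ _
        _ ≤ p.real univ * ‖h‖ + q.real univ * ‖h‖ :=
          add_le_add (h.norm_integral_le_mul_norm p) (h.norm_integral_le_mul_norm q)
        _ = (p.real univ + q.real univ) * ‖h‖ := (add_mul _ _ _).symm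

variable [BorelSpace X]

theorem exists_boundedContinuous_norm_le_one_integral_sub_le [NormalSpace X] {m : Measure X}
    [m.WeaklyRegular] {f : X → ℝ} (hf : Integrable f m) (hf1 : ∀ x, f x ∈ Icc (-1 : ℝ) 1) {ε : ℝ}
    (hε : 0 < ε) : ∃ h : X →ᵇ ℝ, ‖h‖ ≤ 1 ∧ ∫ x, |f x - h x| ∂m ≤ ε := by
  obtain ⟨g, hg, hgint⟩ := hf.exists_boundedContinuous_integral_sub_le hε
  have hclamp : LipschitzWith 1 fun t : ℝ => (projIcc (-1 : ℝ) 1 (by norm_num) t : ℝ) :=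
    LipschitzWith.subtype_val _ |>.comp (LipschitzWith.projIcc _) |>.weaken (by norm_num)
  have h0 : ‖g.comp _ hclamp‖ ≤ 1 := (BoundedContinuousFunction.norm_le zero_le_one).2 fun x =>
    abs_le.2 (projIcc (-1 : ℝ) 1 (by norm_num) (g x)).2
  refine ⟨g.comp _ hclamp, h0, le_trans ?_ hg⟩
  refine integral_mono_of_nonneg (Eventually.of_forall fun x => abs_nonneg _)
    (hf.sub hgint).norm (Eventually.of_forall fun x => ?_)
  have := hclamp.dist_le_mul (f x) (g x)
  simpa [projIcc_of_mem _ (hf1 x), Real.dist_eq] using this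

/-- Test functions close in `L¹(p + q)` to the sign of `p - q` nearly attain the total mass. -/
theorem real_univ_add_le_norm_signedIntegralCLM [NormalSpace X] {p q : Measure X}
    [IsFiniteMeasure p] [IsFiniteMeasure q] [(p + q).WeaklyRegular] (hpq : p ⟂ₘ q) :
    p.real univ + q.real univ ≤ ‖signedIntegralCLM p q‖ := by
  classical
  obtain ⟨A, hA, hpA, hqA⟩ := hpq
  set sgn : X → ℝ := A.piecewise (fun _ => -1) fun _ => 1
  have hsgn1 : ∀ x, sgn x ∈ Icc (-1 : ℝ) 1 := fun x => by
    by_cases hx : x ∈ A <;> simp [sgn, hx]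
  have hsgn : Integrable sgn (p + q) :=
    Integrable.of_bound (Measurable.piecewise hA measurable_const measurable_const
      |>.aestronglyMeasurable) 1 (Eventually.of_forall fun x => abs_le.2 (hsgn1 x))
  have hmass : signedIntegral p q sgn = p.real univ + q.real univ := by
    have hp : sgn =ᵐ[p] fun _ => 1 := by
      filter_upwards [measure_eq_zero_iff_ae_notMem.1 hpA] with x hx
      exact piecewise_eq_of_notMem _ _ _ hx
    have hq : sgn =ᵐ[q] fun _ => -1 := by
      filter_upwards [measure_eq_zero_iff_ae_notMem.1 hqA] with x hx
      exact piecewise_eq_of_mem _ _ _ (not_not.1 hx)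
    simp [signedIntegral, integral_congr_ae hp, integral_congr_ae hq]
  refine le_of_forall_pos_le_add fun ε hε => ?_
  obtain ⟨h, hh1, hh⟩ := exists_boundedContinuous_norm_le_one_integral_sub_le hsgn hsgn1 hε
  have hdiff : signedIntegral p q (fun x => sgn x - h x) ≤ ε := by
    have habs : Integrable (fun x => |sgn x - h x|) (p + q) := (hsgn.sub (h.integrable (p + q))).abs
    refine le_trans ?_ hh
    simp only [signedIntegral]
    rw [integral_add_measure habs.left_of_add_measure habs.right_of_add_measure, sub_eq_add_neg]
    exact add_le_add ((le_abs_self _).trans abs_integral_le_integral_abs)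
      ((neg_le_abs _).trans abs_integral_le_integral_abs)
  calc p.real univ + q.real univ
      = signedIntegral p q h + signedIntegral p q (fun x => sgn x - h x) := by
        rw [signedIntegral_sub hsgn (h.integrable _), hmass]; ring
    _ ≤ ‖signedIntegralCLM p q‖ + ε := add_le_add
        ((le_abs_self _).trans ((signedIntegralCLM p q).unit_le_opNorm h hh1)) hdiff

theorem exists_real_univ_add_le [NormalSpace X] {ι : Type*} {p q : ι → Measure X}
    [∀ i, IsFiniteMeasure (p i)] [∀ i, IsFiniteMeasure (q i)]
    [∀ i, (p i + q i).WeaklyRegular] (hpq : ∀ i, p i ⟂ₘ q i)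
    (hbdd : ∀ h : X →ᵇ ℝ, ∃ C, ∀ i, |signedIntegral (p i) (q i) h| ≤ C) :
    ∃ C, ∀ i, (p i).real univ + (q i).real univ ≤ C := by
  obtain ⟨C, hC⟩ := banach_steinhaus (g := fun i => signedIntegralCLM (p i) (q i)) hbdd
  exact ⟨C, fun i => (real_univ_add_le_norm_signedIntegralCLM (hpq i)).trans (hC i)⟩

end TotalMass

section Kernel

variable {X Y : Type*} [MeasurableSpace X] [MeasurableSpace Y] {l : Measure X} {K : X → Y → ℝ}

theorem lintegral_lintegral_enorm_le [SFinite l] {m : Measure Y} [SFinite m]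
    (hK : Measurable (Function.uncurry K)) {M : ℝ≥0∞} (hM : ∀ y, ∫⁻ x, ‖K x y‖ₑ ∂l ≤ M) :
    ∫⁻ x, ∫⁻ y, ‖K x y‖ₑ ∂m ∂l ≤ M * m univ := by
  rw [lintegral_lintegral_swap (by exact hK.enorm.aemeasurable), ← lintegral_const]
  exact lintegral_mono hM

theorem lintegral_enorm_signedIntegral_le [SFinite l] {p q : Measure Y} [SFinite p] [SFinite q]
    (hK : Measurable (Function.uncurry K)) {M : ℝ≥0∞} (hM : ∀ y, ∫⁻ x, ‖K x y‖ₑ ∂l ≤ M) :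
    ∫⁻ x, ‖signedIntegral p q (K x)‖ₑ ∂l ≤ M * (p + q) univ :=
  (lintegral_mono fun x => enorm_signedIntegral_le p q (K x)).trans
    (lintegral_lintegral_enorm_le hK hM)

theorem ae_integrable_of_lintegral_enorm_le [SFinite l] {m : Measure Y} [IsFiniteMeasure m]
    (hK : Measurable (Function.uncurry K)) {M : ℝ≥0∞} (hMt : M ≠ ⊤)
    (hM : ∀ y, ∫⁻ x, ‖K x y‖ₑ ∂l ≤ M) : ∀ᵐ x ∂l, Integrable (K x) m := by
  have hfin : ∫⁻ x, ∫⁻ y, ‖K x y‖ₑ ∂m ∂l ≠ ⊤ :=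
    ((lintegral_lintegral_enorm_le hK hM).trans_lt
      (ENNReal.mul_lt_top hMt.lt_top (measure_lt_top m univ))).ne
  filter_upwards [ae_lt_top hK.enorm.lintegral_prod_right' hfin] with x hx
  exact ⟨(hK.comp measurable_prodMk_left).aestronglyMeasurable, hx⟩

theorem integrable_signedIntegral [SFinite l] {p q : Measure Y} [IsFiniteMeasure p]
    [IsFiniteMeasure q] (hK : Measurable (Function.uncurry K)) {M : ℝ≥0∞} (hMt : M ≠ ⊤)
    (hM : ∀ y, ∫⁻ x, ‖K x y‖ₑ ∂l ≤ M) : Integrable (fun x => signedIntegral p q (K x)) l :=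
  ⟨(measurable_signedIntegral hK).aestronglyMeasurable,
    (lintegral_enorm_signedIntegral_le hK hM).trans_lt
      (ENNReal.mul_lt_top hMt.lt_top (measure_lt_top (p + q) univ))⟩

theorem tendsto_lintegral_signedIntegral_of_bounded [IsFiniteMeasure l] {p q : ℕ → Measure Y}
    [∀ n, SFinite (p n)] [∀ n, SFinite (q n)] {C : ℝ≥0∞} (hCt : C ≠ ⊤)
    (hC : ∀ n, (p n + q n) univ ≤ C) (hK : Measurable (Function.uncurry K)) {c : ℝ}
    (hc : ∀ x y, |K x y| ≤ c)
    (hlim : ∀ᵐ x ∂l, Tendsto (fun n => signedIntegral (p n) (q n) (K x)) atTop (𝓝 0)) :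
    Tendsto (fun n => ∫⁻ x, ‖signedIntegral (p n) (q n) (K x)‖ₑ ∂l) atTop (𝓝 0) := by
  have hbound : ∀ n x, ‖signedIntegral (p n) (q n) (K x)‖ₑ ≤ ENNReal.ofReal c * C := fun n x =>
    calc ‖signedIntegral (p n) (q n) (K x)‖ₑ ≤ ∫⁻ y, ‖K x y‖ₑ ∂(p n + q n) :=
          enorm_signedIntegral_le _ _ _
      _ ≤ ∫⁻ _, ENNReal.ofReal c ∂(p n + q n) := lintegral_mono fun y =>
          (Real.enorm_eq_ofReal_abs _).trans_le (ENNReal.ofReal_le_ofReal (hc x y))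
      _ ≤ ENNReal.ofReal c * C := by rw [lintegral_const]; gcongr; exact hC n
  rw [← lintegral_zero (μ := l)]
  refine tendsto_lintegral_of_dominated_convergence (fun _ => ENNReal.ofReal c * C)
    (fun n => (measurable_signedIntegral hK).enorm)
    (fun n => Eventually.of_forall (hbound n)) ?_ ?_
  · rw [lintegral_const]
    exact ENNReal.mul_ne_top (ENNReal.mul_ne_top ENNReal.ofReal_ne_top hCt) (measure_ne_top l univ)
  · filter_upwards [hlim] with x hx
    simpa using hx.enorm

theorem tendsto_lintegral_signedIntegral_of_approx [IsFiniteMeasure l] {p q : ℕ → Measure Y}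
    [∀ n, IsFiniteMeasure (p n)] [∀ n, IsFiniteMeasure (q n)] {C : ℝ≥0∞} (hCt : C ≠ ⊤)
    (hC : ∀ n, (p n + q n) univ ≤ C) (hK : Measurable (Function.uncurry K)) {M : ℝ≥0∞}
    (hMt : M ≠ ⊤) (hM : ∀ y, ∫⁻ x, ‖K x y‖ₑ ∂l ≤ M)
    (happrox : ∀ ε > 0, ∃ J : X → Y → ℝ, Measurable (Function.uncurry J) ∧
      (∃ c, ∀ x y, |J x y| ≤ c) ∧ (∀ y, ∫⁻ x, ‖K x y - J x y‖ₑ ∂l ≤ ε) ∧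
      ∀ᵐ x ∂l, Tendsto (fun n => signedIntegral (p n) (q n) (J x)) atTop (𝓝 0)) :
    Tendsto (fun n => ∫⁻ x, ‖signedIntegral (p n) (q n) (K x)‖ₑ ∂l) atTop (𝓝 0) := by
  refine ENNReal.tendsto_nhds_zero.2 fun ε hε => ?_
  have hε2 : 0 < ε / 2 := ENNReal.half_pos hε.ne'
  obtain ⟨J, hJ, ⟨c, hc⟩, hKJ, hlim⟩ := happrox (ε / 2 / C) (ENNReal.div_pos hε2.ne' hCt)
  have hsub : Measurable (Function.uncurry fun x y => K x y - J x y) := hK.sub hJ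
  filter_upwards [ENNReal.tendsto_nhds_zero.1
    (tendsto_lintegral_signedIntegral_of_bounded hCt hC hJ hc hlim) (ε / 2) hε2] with n hn
  have hle : ∀ᵐ x ∂l, ‖signedIntegral (p n) (q n) (K x)‖ₑ ≤
      ‖signedIntegral (p n) (q n) (fun y => K x y - J x y)‖ₑ +
        ‖signedIntegral (p n) (q n) (J x)‖ₑ := by
    filter_upwards [ae_integrable_of_lintegral_enorm_le (m := p n + q n) hK hMt hM] with x hx
    have hJx : Integrable (J x) (p n + q n) :=
      Integrable.of_bound (hJ.comp measurable_prodMk_left).aestronglyMeasurable c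
        (Eventually.of_forall (hc x))
    rw [signedIntegral_sub hx hJx]
    simpa using enorm_add_le (signedIntegral (p n) (q n) (K x) - signedIntegral (p n) (q n) (J x))
      (signedIntegral (p n) (q n) (J x))
  calc ∫⁻ x, ‖signedIntegral (p n) (q n) (K x)‖ₑ ∂l
      ≤ ∫⁻ x, ‖signedIntegral (p n) (q n) (fun y => K x y - J x y)‖ₑ ∂l +
          ∫⁻ x, ‖signedIntegral (p n) (q n) (J x)‖ₑ ∂l :=
        (lintegral_mono_ae hle).trans_eq
          (lintegral_add_left (measurable_signedIntegral hsub).enorm _)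
    _ ≤ ε / 2 / C * C + ε / 2 := by
        gcongr
        exact (lintegral_enorm_signedIntegral_le hsub hKJ).trans (by gcongr; exact hC n)
    _ ≤ ε / 2 + ε / 2 := by gcongr; rw [mul_comm]; exact ENNReal.mul_div_le
    _ = ε := ENNReal.add_halves ε

end Kernel

section DiagonalCutoff

variable {X : Type*} [PseudoMetricSpace X] {K : X → X → ℝ} {r : ℝ}

/-- The kernel `K` multiplied by a continuous cutoff that vanishes where `dist x y ≤ r / 2` and
equals `1` where `r ≤ dist x y`. -/
noncomputable def diagCutoff (K : X → X → ℝ) (r : ℝ) (x y : X) : ℝ :=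
  Real.smoothTransition (2 * dist x y / r - 1) * K x y

theorem continuous_smoothTransition_dist (r : ℝ) :
    Continuous fun z : X × X => Real.smoothTransition (2 * dist z.1 z.2 / r - 1) :=
  Real.smoothTransition.continuous.comp (by fun_prop)

theorem measurable_diagCutoff [MeasurableSpace X] [OpensMeasurableSpace X]
    [SecondCountableTopology X] (hK : Measurable (Function.uncurry K)) (r : ℝ) :
    Measurable (Function.uncurry (diagCutoff K r)) :=
  (continuous_smoothTransition_dist r).measurable.mul hK

theorem diagCutoff_of_dist_le (hr : 0 < r) {x y : X} (h : dist x y ≤ r / 2) :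
    diagCutoff K r x y = 0 := by
  have : 2 * dist x y / r - 1 ≤ 0 := by rw [sub_nonpos, div_le_one hr]; linarith
  rw [diagCutoff, Real.smoothTransition.zero_of_nonpos this, zero_mul]

theorem diagCutoff_of_le_dist (hr : 0 < r) {x y : X} (h : r ≤ dist x y) :
    diagCutoff K r x y = K x y := by
  have : 1 ≤ 2 * dist x y / r - 1 := by rw [le_sub_iff_add_le, le_div_iff₀ hr]; linarith
  rw [diagCutoff, Real.smoothTransition.one_of_one_le this, one_mul]

theorem enorm_sub_diagCutoff_le (hr : 0 < r) (x y : X) :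
    ‖K x y - diagCutoff K r x y‖ₑ ≤ (Metric.ball y r).indicator (fun x => ‖K x y‖ₑ) x := by
  by_cases hx : x ∈ Metric.ball y r
  · have h0 := Real.smoothTransition.nonneg (2 * dist x y / r - 1)
    have h1 := Real.smoothTransition.le_one (2 * dist x y / r - 1)
    rw [indicator_of_mem hx, enorm_le_iff_norm_le, diagCutoff, ← one_sub_mul, norm_mul,
      Real.norm_of_nonneg (sub_nonneg.2 h1)]
    exact mul_le_of_le_one_left (norm_nonneg _) (sub_le_self _ h0)
  · rw [diagCutoff_of_le_dist hr (by simpa using hx)]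
    simp

theorem abs_diagCutoff_le {a c : ℝ} (ha : 0 ≤ a) (hr : 0 < r)
    (hK : ∀ x y, |K x y| ≤ c * dist x y ^ (-a)) (hc : 0 ≤ c) (x y : X) :
    |diagCutoff K r x y| ≤ c * (r / 2) ^ (-a) := by
  rcases le_total (dist x y) (r / 2) with h | h
  · rw [diagCutoff_of_dist_le hr h, abs_zero]
    positivity
  · rw [diagCutoff, abs_mul, abs_of_nonneg (Real.smoothTransition.nonneg _)]
    calc _ ≤ |K x y| := mul_le_of_le_one_left (abs_nonneg _) (Real.smoothTransition.le_one _)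
      _ ≤ c * dist x y ^ (-a) := hK x y
      _ ≤ c * (r / 2) ^ (-a) := by
        gcongr c * ?_
        exact Real.rpow_le_rpow_of_nonpos (half_pos hr) h (neg_nonpos.2 ha)

theorem continuousOn_diagCutoff (hr : 0 < r) {A : Set X} {x : X}
    (hK : ContinuousOn (K x) (A \ {x})) : ContinuousOn (diagCutoff K r x) A := by
  intro y hy
  by_cases hxy : y ∈ Metric.ball x (r / 2)
  · refine (continuousWithinAt_const (b := 0)).congr_of_eventuallyEq_of_mem ?_ hy
    filter_upwards [mem_nhdsWithin_of_mem_nhds (Metric.isOpen_ball.mem_nhds hxy)] with z hz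
    exact diagCutoff_of_dist_le hr (dist_comm z x ▸ (Metric.mem_ball.1 hz).le)
  · have hcut : Continuous fun z => Real.smoothTransition (2 * dist x z / r - 1) :=
      (continuous_smoothTransition_dist r).comp (.prodMk_right x)
    have hoff : A \ {x} ∈ 𝓝[A] y := by
      filter_upwards [self_mem_nhdsWithin,
        mem_nhdsWithin_of_mem_nhds (Metric.ball_mem_nhds y (half_pos hr))] with z hz hzy
      exact ⟨hz, fun hzx => hxy (Metric.mem_ball_comm.1 (mem_singleton_iff.1 hzx ▸ hzy))⟩
    have hyx : y ≠ x := fun h => hxy (h ▸ Metric.mem_ball_self (half_pos hr))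
    exact hcut.continuousWithinAt.mul ((hK y ⟨hy, hyx⟩).mono_of_mem_nhdsWithin hoff)

end DiagonalCutoff

section SingularKernel

variable {E : Type*} [NormedAddCommGroup E] [MeasurableSpace E] [BorelSpace E]

theorem setLIntegral_ball_rpow_dist (m : Measure E) [m.IsAddRightInvariant] (a c r : ℝ) (y : E) :
    ∫⁻ x in Metric.ball y r, ENNReal.ofReal (c * dist x y ^ (-a)) ∂m =
      ∫⁻ z in Metric.ball (0 : E) r, ENNReal.ofReal (c * ‖z‖ ^ (-a)) ∂m := by
  rw [← lintegral_indicator Metric.isOpen_ball.measurableSet,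
    ← lintegral_indicator Metric.isOpen_ball.measurableSet,
    ← lintegral_sub_right_eq_self (μ := m) ((Metric.ball (0 : E) r).indicator _) y]
  refine lintegral_congr fun x => ?_
  simp only [indicator, mem_ball_iff_norm, sub_zero, dist_eq_norm]

theorem setLIntegral_ball_enorm_le {m l : Measure E} [m.IsAddRightInvariant] (hl : l ≤ m)
    {K : E → E → ℝ} {a c : ℝ} (hK : ∀ x y, |K x y| ≤ c * dist x y ^ (-a)) (r : ℝ) (y : E) :
    ∫⁻ x in Metric.ball y r, ‖K x y‖ₑ ∂l ≤
      ∫⁻ z in Metric.ball (0 : E) r, ENNReal.ofReal (c * ‖z‖ ^ (-a)) ∂m := by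
  rw [← setLIntegral_ball_rpow_dist m a c r y]
  exact lintegral_mono' (Measure.restrict_mono subset_rfl hl) fun x =>
    (Real.enorm_eq_ofReal_abs _).trans_le (ENNReal.ofReal_le_ofReal (hK x y))

variable [NormedSpace ℝ E] [FiniteDimensional ℝ E] {m : Measure E} [m.IsAddHaarMeasure] {a c : ℝ}

theorem setLIntegral_ball_rpow_norm_lt_top (ha : 0 ≤ a) (had : a < Module.finrank ℝ E)
    (hc : 0 ≤ c) (r : ℝ) :
    ∫⁻ z in Metric.ball (0 : E) r, ENNReal.ofReal (c * ‖z‖ ^ (-a)) ∂m < ⊤ := by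
  have hd : 1 ≤ Module.finrank ℝ E := by exact_mod_cast ha.trans_lt had
  have hint : IntegrableOn (fun z : E => c * ‖z‖ ^ (-a)) (Metric.ball 0 r) m :=
    integrableOn_ball_of_norm_le_rpow (C := c) hd had (Eventually.of_forall fun z =>
      (Real.norm_of_nonneg (by positivity)).le) (Measurable.aestronglyMeasurable (by fun_prop))
  exact (hasFiniteIntegral_iff_ofReal (Eventually.of_forall fun z => by positivity)).1 hint.2

theorem tendsto_setLIntegral_ball_rpow_norm (ha : 0 ≤ a) (had : a < Module.finrank ℝ E)
    (hc : 0 ≤ c) :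
    Tendsto (fun r => ∫⁻ z in Metric.ball (0 : E) r, ENNReal.ofReal (c * ‖z‖ ^ (-a)) ∂m)
      (𝓝[>] 0) (𝓝 0) := by
  have : Nontrivial E :=
    Module.nontrivial_of_finrank_pos (R := ℝ) (by exact_mod_cast ha.trans_lt had)
  set w := m.withDensity fun z : E => ENNReal.ofReal (c * ‖z‖ ^ (-a))
  have hw0 : w {0} = 0 := withDensity_absolutelyContinuous _ _ (measure_singleton 0)
  have hball : ∀ r, w (Metric.thickening r {0}) =
      ∫⁻ z in Metric.ball (0 : E) r, ENNReal.ofReal (c * ‖z‖ ^ (-a)) ∂m := fun r => by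
    rw [Metric.thickening_singleton, withDensity_apply _ Metric.isOpen_ball.measurableSet]
  simpa only [hball, hw0] using tendsto_measure_thickening_of_isClosed (μ := w) (s := {0})
    ⟨1, one_pos, by rw [hball]; exact (setLIntegral_ball_rpow_norm_lt_top ha had hc 1).ne⟩
    isClosed_singleton

variable {l : Measure E} [IsFiniteMeasure l] {K : E → E → ℝ}

theorem exists_lintegral_enorm_le (hl : l ≤ m) (ha : 0 ≤ a) (had : a < Module.finrank ℝ E)
    (hc : 0 ≤ c) (hK : ∀ x y, |K x y| ≤ c * dist x y ^ (-a)) :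
    ∃ M ≠ ⊤, ∀ y, ∫⁻ x, ‖K x y‖ₑ ∂l ≤ M := by
  refine ⟨∫⁻ z in Metric.ball (0 : E) 1, ENNReal.ofReal (c * ‖z‖ ^ (-a)) ∂m +
    ENNReal.ofReal c * l univ, ?_, fun y => ?_⟩
  · exact ENNReal.add_ne_top.2 ⟨(setLIntegral_ball_rpow_norm_lt_top ha had hc 1).ne,
      ENNReal.mul_ne_top ENNReal.ofReal_ne_top (measure_ne_top l univ)⟩
  · have hfar : ∀ x ∈ (Metric.ball y 1)ᶜ, ‖K x y‖ₑ ≤ ENNReal.ofReal c := fun x hx => by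
      rw [Real.enorm_eq_ofReal_abs]
      refine ENNReal.ofReal_le_ofReal ((hK x y).trans (mul_le_of_le_one_right hc ?_))
      exact Real.rpow_le_one_of_one_le_of_nonpos (by simpa using hx) (neg_nonpos.2 ha)
    rw [← lintegral_add_compl _ (Metric.isOpen_ball (x := y) (ε := 1)).measurableSet]
    refine add_le_add (setLIntegral_ball_enorm_le hl hK 1 y) ?_
    calc ∫⁻ x in (Metric.ball y 1)ᶜ, ‖K x y‖ₑ ∂l
        ≤ ∫⁻ _ in (Metric.ball y 1)ᶜ, ENNReal.ofReal c ∂l :=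
          setLIntegral_mono' Metric.isOpen_ball.measurableSet.compl hfar
      _ ≤ ENNReal.ofReal c * l univ := by
          rw [setLIntegral_const]
          gcongr
          exact subset_univ _

theorem tendsto_lintegral_signedIntegral_of_diagCutoff (hl : l ≤ m) (ha : 0 ≤ a)
    (had : a < Module.finrank ℝ E) (hc : 0 ≤ c) (hKm : Measurable (Function.uncurry K))
    (hK : ∀ x y, |K x y| ≤ c * dist x y ^ (-a)) {p q : ℕ → Measure E}
    [∀ n, IsFiniteMeasure (p n)] [∀ n, IsFiniteMeasure (q n)] {C : ℝ≥0∞} (hCt : C ≠ ⊤)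
    (hC : ∀ n, (p n + q n) univ ≤ C)
    (hlim : ∀ r > 0, ∀ᵐ x ∂l,
      Tendsto (fun n => signedIntegral (p n) (q n) (diagCutoff K r x)) atTop (𝓝 0)) :
    Tendsto (fun n => ∫⁻ x, ‖signedIntegral (p n) (q n) (K x)‖ₑ ∂l) atTop (𝓝 0) := by
  obtain ⟨M, hMt, hM⟩ := exists_lintegral_enorm_le hl ha had hc hK
  refine tendsto_lintegral_signedIntegral_of_approx hCt hC hKm hMt hM fun ε hε => ?_
  obtain ⟨r, hrε, hr : 0 < r⟩ := ((ENNReal.tendsto_nhds_zero.1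
    (tendsto_setLIntegral_ball_rpow_norm (m := m) ha had hc) ε hε).and self_mem_nhdsWithin).exists
  refine ⟨diagCutoff K r, measurable_diagCutoff hKm r,
    ⟨_, abs_diagCutoff_le ha hr hK hc⟩, fun y => ?_, hlim r hr⟩
  calc ∫⁻ x, ‖K x y - diagCutoff K r x y‖ₑ ∂l
      ≤ ∫⁻ x, (Metric.ball y r).indicator (fun x => ‖K x y‖ₑ) x ∂l :=
        lintegral_mono fun x => enorm_sub_diagCutoff_le hr x y
    _ = ∫⁻ x in Metric.ball y r, ‖K x y‖ₑ ∂l :=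
        lintegral_indicator Metric.isOpen_ball.measurableSet _
    _ ≤ ε := (setLIntegral_ball_enorm_le hl hK r y).trans hrε

end SingularKernel

section Weight

variable {X : Type*} [MeasurableSpace X] {w : X → ℝ} {m : Measure X}

/-- The measure `w m` with density `w` with respect to `m`. Negative values of `w` count as `0`. -/
noncomputable def weightedMeasure (w : X → ℝ) (m : Measure X) : Measure X :=
  m.withDensity fun x => ENNReal.ofReal (w x)

theorem integral_weightedMeasure (hw : Measurable w) (hw0 : ∀ x, 0 ≤ w x) (f : X → ℝ) :
    ∫ x, f x ∂(weightedMeasure w m) = ∫ x, w x * f x ∂m := by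
  rw [weightedMeasure, integral_withDensity_eq_integral_toReal_smul hw.ennreal_ofReal
    (Eventually.of_forall fun x => ENNReal.ofReal_lt_top)]
  simp only [ENNReal.toReal_ofReal (hw0 _), smul_eq_mul]

theorem integrable_weightedMeasure_iff (hw : Measurable w) (hw0 : ∀ x, 0 ≤ w x) {f : X → ℝ} :
    Integrable f (weightedMeasure w m) ↔ Integrable (fun x => w x * f x) m := by
  rw [weightedMeasure, integrable_withDensity_iff_integrable_smul' hw.ennreal_ofReal
    (Eventually.of_forall fun x => ENNReal.ofReal_lt_top)]
  simp only [ENNReal.toReal_ofReal (hw0 _), smul_eq_mul]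

theorem eLpNorm_one_weightedMeasure (hw : Measurable w) (hw0 : ∀ x, 0 ≤ w x) (f : X → ℝ) :
    eLpNorm f 1 (weightedMeasure w m) = ∫⁻ x, ‖w x * f x‖ₑ ∂m := by
  rw [eLpNorm_one_eq_lintegral_enorm, weightedMeasure,
    lintegral_withDensity_eq_lintegral_mul_non_measurable _ hw.ennreal_ofReal
      (Eventually.of_forall fun x => ENNReal.ofReal_lt_top)]
  refine lintegral_congr fun x => ?_
  rw [Pi.mul_apply, enorm_mul, Real.enorm_of_nonneg (hw0 x)]

variable [MeasurableSingletonClass X]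

theorem ae_measure_singleton_eq_zero (l m : Measure X) [NullSingletonClass l] [SFinite m] :
    ∀ᵐ x ∂l, m {x} = 0 := by
  have hc : {x | 0 < m {x}}.Countable :=
    Measure.countable_meas_pos_of_disjoint_iUnion (fun x => measurableSet_singleton x)
      fun x y hxy => disjoint_singleton.2 hxy
  filter_upwards [hc.ae_notMem l] with x hx
  exact nonpos_iff_eq_zero.1 (not_lt.1 hx)

theorem ae_measure_singleton_eq_zero_of_weightedMeasure (l : Measure X) [NullSingletonClass l]
    [SFinite (weightedMeasure w m)] : ∀ᵐ x ∂l, 0 < w x → m {x} = 0 := by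
  filter_upwards [ae_measure_singleton_eq_zero l (weightedMeasure w m)] with x hx hwx
  rw [weightedMeasure, withDensity_apply _ (measurableSet_singleton x), lintegral_singleton,
    mul_eq_zero] at hx
  exact hx.resolve_left (ENNReal.ofReal_pos.2 hwx).ne'

end Weight

section WeightedKernel

variable {X : Type*} {S : Set X} {w : X → ℝ} {G : X → X → ℝ}

/-- The kernel `w(x) G(x, y) / w(y)` off the diagonal of `S × S`, extended by zero. It turns `G`
acting on measures `m` with values in the weighted space `L¹(w)` into an unweighted kernel acting
on the measures `w m`. -/
noncomputable def weightedKernel (S : Set X) (w : X → ℝ) (G : X → X → ℝ) (x y : X) : ℝ :=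
  S.offDiag.indicator (fun z => w z.1 * (G z.1 z.2 / w z.2)) (x, y)

theorem weightedKernel_of_mem {x y : X} (h : (x, y) ∈ S.offDiag) :
    weightedKernel S w G x y = w x * (G x y / w y) :=
  indicator_of_mem h _

theorem weightedKernel_of_notMem {x y : X} (h : (x, y) ∉ S.offDiag) :
    weightedKernel S w G x y = 0 :=
  indicator_of_notMem h _

theorem abs_weightedKernel_le [PseudoMetricSpace X] {a c : ℝ} (hc : 0 ≤ c)
    (hw : ∀ x ∈ S, 0 < w x)
    (hG : ∀ x ∈ S, ∀ y ∈ S, x ≠ y → w x * |G x y| ≤ c * w y * dist x y ^ (-a)) (x y : X) :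
    |weightedKernel S w G x y| ≤ c * dist x y ^ (-a) := by
  by_cases h : (x, y) ∈ S.offDiag
  · have hy := hw y h.2.1
    rw [weightedKernel_of_mem h, abs_mul, abs_div, abs_of_pos (hw x h.1), abs_of_pos hy,
      ← mul_div_assoc, div_le_iff₀ hy, mul_right_comm]
    exact hG x h.1 y h.2.1 h.2.2
  · rw [weightedKernel_of_notMem h, abs_zero]
    positivity

variable [MeasurableSpace X]

theorem measurable_weightedKernel [MeasurableEq X] (hS : MeasurableSet S) (hw : Measurable w)
    (hG : Measurable (S.offDiag.domRestrict (Function.uncurry G))) :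
    Measurable (Function.uncurry (weightedKernel S w G)) := by
  have hoff : MeasurableSet S.offDiag := by
    rw [← prod_sdiff_diagonal]
    exact (hS.prod hS).diff measurableSet_diagonal
  refine measurable_of_restrict_of_restrict_compl hoff ?_ ?_
  · have h : Measurable fun z : S.offDiag => w z.1.1 *
        (S.offDiag.domRestrict (Function.uncurry G) z / w z.1.2) :=
      (hw.comp (measurable_fst.comp measurable_subtype_coe)).mul
        (hG.div (hw.comp (measurable_snd.comp measurable_subtype_coe)))
    convert h using 1
    exact funext fun z => weightedKernel_of_mem z.2
  · convert measurable_const (a := (0 : ℝ)) using 1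
    exact funext fun z => weightedKernel_of_notMem z.2

theorem mul_weightedKernel_ae_eq (hw : ∀ x ∈ S, 0 < w x) {m : Measure X} (hm : m Sᶜ = 0) {x : X}
    (hx : x ∈ S) (hmx : m {x} = 0) :
    (fun y => w y * weightedKernel S w G x y) =ᵐ[m] fun y => w x * G x y := by
  filter_upwards [measure_eq_zero_iff_ae_notMem.1 hm, measure_eq_zero_iff_ae_notMem.1 hmx]
    with y hy hyx
  have hyS : y ∈ S := not_not.1 hy
  rw [weightedKernel_of_mem ⟨hx, hyS, fun h => hyx h.symm⟩, ← mul_div_assoc,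
    mul_div_cancel₀ _ (hw y hyS).ne']

theorem integrable_weightedKernel_iff (hwm : Measurable w) (hw0 : ∀ x, 0 ≤ w x)
    (hw : ∀ x ∈ S, 0 < w x) {m : Measure X} (hm : m Sᶜ = 0) {x : X} (hx : x ∈ S)
    (hmx : m {x} = 0) :
    Integrable (weightedKernel S w G x) (weightedMeasure w m) ↔ Integrable (G x) m := by
  rw [integrable_weightedMeasure_iff hwm hw0,
    integrable_congr (mul_weightedKernel_ae_eq hw hm hx hmx),
    integrable_const_mul_iff (hw x hx).ne'.isUnit]

theorem integral_weightedKernel (hwm : Measurable w) (hw0 : ∀ x, 0 ≤ w x)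
    (hw : ∀ x ∈ S, 0 < w x) {m : Measure X} (hm : m Sᶜ = 0) {x : X} (hx : x ∈ S)
    (hmx : m {x} = 0) :
    ∫ y, weightedKernel S w G x y ∂(weightedMeasure w m) = w x * ∫ y, G x y ∂m := by
  rw [integral_weightedMeasure hwm hw0,
    integral_congr_ae (mul_weightedKernel_ae_eq hw hm hx hmx), integral_const_mul]

end WeightedKernel

theorem exists_continuousOn_closure_eqOn {X Y : Type*} [TopologicalSpace X] [TopologicalSpace Y]
    [T3Space Y] {A : Set X} {f : X → Y} (hf : ContinuousOn f A)
    (hlim : ∀ z ∈ frontier A, ∃ b, Tendsto f (𝓝[A] z) (𝓝 b)) :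
    ∃ h : X → Y, ContinuousOn h (closure A) ∧ EqOn h f A := by
  refine ⟨extendFrom A f, continuousOn_extendFrom subset_rfl fun z hz => ?_,
    fun z hz => extendFrom_eq (subset_closure hz) (hf z hz)⟩
  by_cases hzA : z ∈ A
  · exact ⟨f z, hf z hzA⟩
  · exact hlim z ⟨hz, fun h => hzA (interior_subset h)⟩

section BoundaryDistance

variable {N : ℕ} {Ω : Set (Space N)} {γ : ℝ}

theorem bdist_pos (ho : IsOpen Ω) (hne : Ωᶜ.Nonempty) {x : Space N} (hx : x ∈ Ω) :
    0 < bdist Ω x :=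
  (ho.isClosed_compl.notMem_iff_infDist_pos hne).1 (not_not.2 hx)

theorem bdist_rpow_pos (ho : IsOpen Ω) (hne : Ωᶜ.Nonempty) (γ : ℝ) {x : Space N} (hx : x ∈ Ω) :
    0 < bdist Ω x ^ γ :=
  Real.rpow_pos_of_pos (bdist_pos ho hne hx) γ

theorem bdist_rpow_nonneg (Ω : Set (Space N)) (γ : ℝ) (x : Space N) : 0 ≤ bdist Ω x ^ γ :=
  Real.rpow_nonneg Metric.infDist_nonneg γ

theorem measurable_bdist_rpow (Ω : Set (Space N)) (γ : ℝ) : Measurable fun x => bdist Ω x ^ γ :=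
  (Metric.continuous_infDist_pt _).measurable.pow_const γ

theorem continuousOn_bdist_rpow (ho : IsOpen Ω) (hne : Ωᶜ.Nonempty) (γ : ℝ) :
    ContinuousOn (fun x => bdist Ω x ^ γ) Ω :=
  (Metric.continuous_infDist_pt _).continuousOn.rpow_const fun _ hx =>
    Or.inl (bdist_pos ho hne hx).ne'

theorem exists_continuousOn_closure_eqOn_diagCutoff (ho : IsOpen Ω) (hne : Ωᶜ.Nonempty)
    {G : Space N → Space N → ℝ} {x : Space N} (hx : x ∈ Ω) (hG : ContinuousOn (G x) (Ω \ {x}))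
    (hlim : ∀ z ∈ frontier Ω, ∃ b, Tendsto (fun y => G x y / bdist Ω y ^ γ) (𝓝[Ω] z) (𝓝 b))
    {r : ℝ} (hr : 0 < r) :
    ∃ h : Space N → ℝ, ContinuousOn h (closure Ω) ∧
      EqOn h (diagCutoff (weightedKernel Ω (bdist Ω · ^ γ) G) r x) Ω := by
  have heq : EqOn (weightedKernel Ω (bdist Ω · ^ γ) G x)
      (fun y => bdist Ω x ^ γ * (G x y / bdist Ω y ^ γ)) (Ω \ {x}) := fun y hy =>
    weightedKernel_of_mem ⟨hx, hy.1, fun h => hy.2 h.symm⟩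
  have hcont : ContinuousOn (weightedKernel Ω (bdist Ω · ^ γ) G x) (Ω \ {x}) :=
    ((hG.div ((continuousOn_bdist_rpow ho hne γ).mono sdiff_subset) fun y hy =>
      (bdist_rpow_pos ho hne γ hy.1).ne').const_mul _).congr heq
  refine exists_continuousOn_closure_eqOn (continuousOn_diagCutoff hr hcont) fun z hz => ?_
  obtain ⟨b, hb⟩ := hlim z hz
  have hzx : z ≠ x := fun h => hz.2 (by rwa [h, ho.interior_eq])
  have hcut : Tendsto (fun y => Real.smoothTransition (2 * dist x y / r - 1)) (𝓝[Ω] z)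
      (𝓝 (Real.smoothTransition (2 * dist x z / r - 1))) :=
    (((continuous_smoothTransition_dist r).comp (.prodMk_right x)).tendsto z).mono_left
      nhdsWithin_le_nhds
  refine ⟨_, (hcut.mul (hb.const_mul (bdist Ω x ^ γ))).congr' ?_⟩
  filter_upwards [self_mem_nhdsWithin, mem_nhdsWithin_of_mem_nhds (isOpen_ne.mem_nhds hzx)]
    with y hy hyx
  rw [diagCutoff, heq ⟨hy, hyx⟩]

end BoundaryDistance

namespace SignedRadonMeasure

variable {N : ℕ} {Ω : Set (Space N)} {γ : ℝ} {μ : SignedRadonMeasure Ω}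

/-- The measure `δ^γ μ⁺`. It is finite when `μ ∈ 𝓜(Ω, δ^γ)`, although `μ⁺` need not be. -/
noncomputable def weightedPos (γ : ℝ) (μ : SignedRadonMeasure Ω) : Measure (Space N) :=
  weightedMeasure (bdist Ω · ^ γ) μ.pos

/-- The measure `δ^γ μ⁻`. It is finite when `μ ∈ 𝓜(Ω, δ^γ)`, although `μ⁻` need not be. -/
noncomputable def weightedNeg (γ : ℝ) (μ : SignedRadonMeasure Ω) : Measure (Space N) :=
  weightedMeasure (bdist Ω · ^ γ) μ.neg

theorem MemWeighted.isFiniteMeasure_weightedPos (h : μ.MemWeighted γ) :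
    IsFiniteMeasure (weightedPos γ μ) :=
  isFiniteMeasure_withDensity
    ((lintegral_mono' (Measure.le_add_right le_rfl) le_rfl).trans_lt h).ne

theorem MemWeighted.isFiniteMeasure_weightedNeg (h : μ.MemWeighted γ) :
    IsFiniteMeasure (weightedNeg γ μ) :=
  isFiniteMeasure_withDensity
    ((lintegral_mono' (Measure.le_add_left le_rfl) le_rfl).trans_lt h).ne

theorem mutuallySingular_weighted (γ : ℝ) (μ : SignedRadonMeasure Ω) :
    weightedPos γ μ ⟂ₘ weightedNeg γ μ :=
  μ.mutuallySingular.mono_ac (withDensity_absolutelyContinuous _ _)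
    (withDensity_absolutelyContinuous _ _)

theorem integral_congr_of_eqOn (μ : SignedRadonMeasure Ω) {f g : Space N → ℝ} (h : EqOn f g Ω) :
    μ.integral f = μ.integral g := by
  have hae : ∀ m : Measure (Space N), m Ωᶜ = 0 → f =ᵐ[m] g := fun m hm => by
    filter_upwards [measure_eq_zero_iff_ae_notMem.1 hm] with x hx
    exact h (not_not.1 hx)
  rw [SignedRadonMeasure.integral, integral_congr_ae (hae _ μ.pos_compl),
    integral_congr_ae (hae _ μ.neg_compl), SignedRadonMeasure.integral]

theorem signedIntegral_weighted (γ : ℝ) (μ : SignedRadonMeasure Ω) (f : Space N → ℝ) :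
    signedIntegral (weightedPos γ μ) (weightedNeg γ μ) f =
      μ.integral fun x => bdist Ω x ^ γ * f x := by
  rw [signedIntegral, weightedPos, weightedNeg,
    integral_weightedMeasure (measurable_bdist_rpow Ω γ) (bdist_rpow_nonneg Ω γ),
    integral_weightedMeasure (measurable_bdist_rpow Ω γ) (bdist_rpow_nonneg Ω γ),
    SignedRadonMeasure.integral]

theorem exists_weighted_univ_le {μ : ℕ → SignedRadonMeasure Ω} {μlim : SignedRadonMeasure Ω}
    (hμ : ∀ n, (μ n).MemWeighted γ) (hconv : WeaklyConverges γ μ μlim) :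
    ∃ C ≠ ⊤, ∀ n, (weightedPos γ (μ n) + weightedNeg γ (μ n)) univ ≤ C := by
  have := fun n => (hμ n).isFiniteMeasure_weightedPos
  have := fun n => (hμ n).isFiniteMeasure_weightedNeg
  obtain ⟨C, hC⟩ := exists_real_univ_add_le (fun n => mutuallySingular_weighted γ (μ n))
    fun h => by
      obtain ⟨C, hC⟩ := (hconv h h.continuous.continuousOn).abs.bddAbove_range
      exact ⟨C, fun n => by rw [signedIntegral_weighted]; exact hC ⟨n, rfl⟩⟩
  refine ⟨ENNReal.ofReal C, ENNReal.ofReal_ne_top, fun n => ?_⟩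
  rw [← ofReal_measureReal, measureReal_add_apply]
  exact ENNReal.ofReal_le_ofReal (hC n)

theorem tendsto_signedIntegral_weighted {μ : ℕ → SignedRadonMeasure Ω}
    {μlim : SignedRadonMeasure Ω} (hconv : WeaklyConverges γ μ μlim) {f h : Space N → ℝ}
    (hh : ContinuousOn h (closure Ω)) (hf : EqOn h f Ω) :
    Tendsto (fun n => signedIntegral (weightedPos γ (μ n)) (weightedNeg γ (μ n)) f) atTop
      (𝓝 (signedIntegral (weightedPos γ μlim) (weightedNeg γ μlim) f)) := by
  have hcongr : ∀ ν : SignedRadonMeasure Ω,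
      signedIntegral (weightedPos γ ν) (weightedNeg γ ν) f =
        ν.integral fun x => bdist Ω x ^ γ * h x := fun ν => by
    rw [signedIntegral_weighted]
    exact ν.integral_congr_of_eqOn fun x hx => by rw [hf hx]
  simpa only [hcongr] using hconv h hh

theorem MemWeighted.ae_measure_singleton_eq_zero [NeZero N] (h : μ.MemWeighted γ) (ho : IsOpen Ω)
    (hne : Ωᶜ.Nonempty) :
    ∀ᵐ x ∂(volume.restrict Ω), x ∈ Ω ∧ μ.pos {x} = 0 ∧ μ.neg {x} = 0 := by
  have : SFinite (weightedMeasure (bdist Ω · ^ γ) μ.pos) :=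
    have := h.isFiniteMeasure_weightedPos; inferInstanceAs (SFinite (weightedPos γ μ))
  have : SFinite (weightedMeasure (bdist Ω · ^ γ) μ.neg) :=
    have := h.isFiniteMeasure_weightedNeg; inferInstanceAs (SFinite (weightedNeg γ μ))
  filter_upwards [ae_measure_singleton_eq_zero_of_weightedMeasure (m := μ.pos)
      (w := (bdist Ω · ^ γ)) (volume.restrict Ω),
    ae_measure_singleton_eq_zero_of_weightedMeasure (m := μ.neg)
      (w := (bdist Ω · ^ γ)) (volume.restrict Ω), ae_restrict_mem ho.measurableSet] with x hp hn hx
  have hw := bdist_rpow_pos ho hne γ hx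
  exact ⟨hx, hp hw, hn hw⟩

end SignedRadonMeasure

section Green

variable {N : ℕ} {Ω : Set (Space N)} {γ : ℝ} {G : Space N → Space N → ℝ}

open SignedRadonMeasure

theorem bdist_rpow_mul_greenMeas_ae_eq [NeZero N] (ho : IsOpen Ω) (hne : Ωᶜ.Nonempty)
    (G : Space N → Space N → ℝ) {μ : SignedRadonMeasure Ω} (hμ : μ.MemWeighted γ) :
    (fun x => bdist Ω x ^ γ * greenMeas G μ x) =ᵐ[volume.restrict Ω] fun x =>
      signedIntegral (weightedPos γ μ) (weightedNeg γ μ)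
        (weightedKernel Ω (bdist Ω · ^ γ) G x) := by
  filter_upwards [hμ.ae_measure_singleton_eq_zero ho hne] with x ⟨hx, hp, hn⟩
  have hint : ∀ m : Measure (Space N), m Ωᶜ = 0 → m {x} = 0 →
      ∫ y, weightedKernel Ω (bdist Ω · ^ γ) G x y ∂(weightedMeasure (bdist Ω · ^ γ) m) =
        bdist Ω x ^ γ * ∫ y, G x y ∂m := fun m hm hmx =>
    integral_weightedKernel (measurable_bdist_rpow Ω γ) (bdist_rpow_nonneg Ω γ)
      (fun _ => bdist_rpow_pos ho hne γ) hm hx hmx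
  rw [signedIntegral, weightedPos, weightedNeg, hint _ μ.pos_compl hp, hint _ μ.neg_compl hn,
    ← mul_sub, greenMeas, SignedRadonMeasure.integral]

theorem greenMemL1_of_lintegral_le [NeZero N] (ho : IsOpen Ω) (hne : Ωᶜ.Nonempty)
    (hK : Measurable (Function.uncurry (weightedKernel Ω (bdist Ω · ^ γ) G))) {M : ℝ≥0∞}
    (hMt : M ≠ ⊤)
    (hM : ∀ y, ∫⁻ x in Ω, ‖weightedKernel Ω (bdist Ω · ^ γ) G x y‖ₑ ≤ M)
    {μ : SignedRadonMeasure Ω} (hμ : μ.MemWeighted γ) : GreenMemL1 γ G μ := by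
  have := hμ.isFiniteMeasure_weightedPos
  have := hμ.isFiniteMeasure_weightedNeg
  constructor
  · filter_upwards [hμ.ae_measure_singleton_eq_zero ho hne,
      ae_integrable_of_lintegral_enorm_le (m := weightedPos γ μ) hK hMt hM,
      ae_integrable_of_lintegral_enorm_le (m := weightedNeg γ μ) hK hMt hM]
      with x ⟨hx, hpx, hnx⟩ hp hn
    have hiff : ∀ m : Measure (Space N), m Ωᶜ = 0 → m {x} = 0 →
        Integrable (weightedKernel Ω (bdist Ω · ^ γ) G x)
          (weightedMeasure (bdist Ω · ^ γ) m) → Integrable (G x) m := fun m hm hmx =>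
      (integrable_weightedKernel_iff (measurable_bdist_rpow Ω γ) (bdist_rpow_nonneg Ω γ)
        (fun _ => bdist_rpow_pos ho hne γ) hm hx hmx).1
    exact (hiff _ μ.pos_compl hpx hp).add_measure (hiff _ μ.neg_compl hnx hn)
  · exact memLp_one_iff_integrable.2 <|
      (integrable_weightedMeasure_iff (measurable_bdist_rpow Ω γ) (bdist_rpow_nonneg Ω γ)).2 <|
        (integrable_signedIntegral hK hMt hM).congr
          (bdist_rpow_mul_greenMeas_ae_eq ho hne G hμ).symm

theorem eLpNorm_greenMeas_sub_eq [NeZero N] (ho : IsOpen Ω) (hne : Ωᶜ.Nonempty)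
    (hK : Measurable (Function.uncurry (weightedKernel Ω (bdist Ω · ^ γ) G))) {M : ℝ≥0∞}
    (hMt : M ≠ ⊤)
    (hM : ∀ y, ∫⁻ x in Ω, ‖weightedKernel Ω (bdist Ω · ^ γ) G x y‖ₑ ≤ M)
    {μ ν : SignedRadonMeasure Ω} (hμ : μ.MemWeighted γ) (hν : ν.MemWeighted γ) :
    eLpNorm (fun x => greenMeas G μ x - greenMeas G ν x) 1 (weightedVolume Ω γ) =
      ∫⁻ x in Ω, ‖signedIntegral (weightedPos γ μ + weightedNeg γ ν)
        (weightedNeg γ μ + weightedPos γ ν) (weightedKernel Ω (bdist Ω · ^ γ) G x)‖ₑ := by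
  have := hμ.isFiniteMeasure_weightedPos
  have := hμ.isFiniteMeasure_weightedNeg
  have := hν.isFiniteMeasure_weightedPos
  have := hν.isFiniteMeasure_weightedNeg
  refine (eLpNorm_one_weightedMeasure (measurable_bdist_rpow Ω γ)
    (bdist_rpow_nonneg Ω γ) _).trans (lintegral_congr_ae ?_)
  filter_upwards [bdist_rpow_mul_greenMeas_ae_eq ho hne G hμ,
    bdist_rpow_mul_greenMeas_ae_eq ho hne G hν,
    ae_integrable_of_lintegral_enorm_le (m := weightedPos γ μ + weightedNeg γ μ) hK hMt hM,
    ae_integrable_of_lintegral_enorm_le (m := weightedPos γ ν + weightedNeg γ ν) hK hMt hM]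
    with x hμx hνx hμint hνint
  rw [signedIntegral_add_swap hμint hνint, mul_sub, hμx, hνx]

theorem tendsto_signedIntegral_diagCutoff (ho : IsOpen Ω) (hne : Ωᶜ.Nonempty)
    (hK : Measurable (Function.uncurry (weightedKernel Ω (bdist Ω · ^ γ) G))) {r c : ℝ}
    (hr : 0 < r) (hc : ∀ x y, |diagCutoff (weightedKernel Ω (bdist Ω · ^ γ) G) r x y| ≤ c)
    {x : Space N} (hx : x ∈ Ω) (hG : ContinuousOn (G x) (Ω \ {x}))
    (hlim : ∀ z ∈ frontier Ω, ∃ b, Tendsto (fun y => G x y / bdist Ω y ^ γ) (𝓝[Ω] z) (𝓝 b))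
    {μ : ℕ → SignedRadonMeasure Ω} {μlim : SignedRadonMeasure Ω}
    (hμ : ∀ n, (μ n).MemWeighted γ) (hμlim : μlim.MemWeighted γ)
    (hconv : WeaklyConverges γ μ μlim) :
    Tendsto (fun n => signedIntegral (weightedPos γ (μ n) + weightedNeg γ μlim)
      (weightedNeg γ (μ n) + weightedPos γ μlim)
      (diagCutoff (weightedKernel Ω (bdist Ω · ^ γ) G) r x)) atTop (𝓝 0) := by
  have hint : ∀ ν : SignedRadonMeasure Ω, ν.MemWeighted γ →
      Integrable (diagCutoff (weightedKernel Ω (bdist Ω · ^ γ) G) r x)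
        (weightedPos γ ν + weightedNeg γ ν) := fun ν hν => by
    have := hν.isFiniteMeasure_weightedPos
    have := hν.isFiniteMeasure_weightedNeg
    exact Integrable.of_bound
      ((measurable_diagCutoff hK r).comp measurable_prodMk_left).aestronglyMeasurable c
      (Eventually.of_forall (hc x))
  obtain ⟨h, hh, heq⟩ := exists_continuousOn_closure_eqOn_diagCutoff ho hne hx hG hlim hr
  simp only [fun n => signedIntegral_add_swap (hint _ (hμ n)) (hint _ hμlim)]
  exact tendsto_sub_nhds_zero_iff.2 (tendsto_signedIntegral_weighted hconv hh heq)

end Green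

section GreenKernel

variable {N : ℕ} {Ω : Set (Space N)} {s γ : ℝ} {G : Space N → Space N → ℝ}

theorem bdist_mul_min_div_le (x : Space N) {y : Space N} (hxy : 0 < dist x y) :
    bdist Ω x * min (bdist Ω y / dist x y) 1 ≤ 2 * bdist Ω y := by
  have hx : bdist Ω x ≤ bdist Ω y + dist x y := Metric.infDist_le_infDist_add_dist
  have hx0 : 0 ≤ bdist Ω x := Metric.infDist_nonneg
  rcases le_total (dist x y) (bdist Ω y) with hle | hle
  · calc bdist Ω x * min (bdist Ω y / dist x y) 1 ≤ bdist Ω x * 1 := by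
          gcongr; exact min_le_right _ _
      _ ≤ 2 * bdist Ω y := by linarith
  · have hy0 : 0 ≤ bdist Ω y := Metric.infDist_nonneg
    calc bdist Ω x * min (bdist Ω y / dist x y) 1
        ≤ (2 * dist x y) * (bdist Ω y / dist x y) := by
          gcongr
          · linarith
          · exact min_le_left _ _
      _ = 2 * bdist Ω y := by field_simp

theorem bdist_rpow_mul_greenProfile_le (hγ : 0 ≤ γ) {x y : Space N} (hxy : x ≠ y) :
    bdist Ω x ^ γ * greenProfile Ω s γ x y ≤
      2 ^ γ * bdist Ω y ^ γ * dist x y ^ (-((N : ℝ) - 2 * s)) := by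
  have hd : 0 < dist x y := dist_pos.2 hxy
  have hx0 : 0 ≤ bdist Ω x := Metric.infDist_nonneg
  have hy0 : 0 ≤ bdist Ω y := Metric.infDist_nonneg
  have hmx : min (bdist Ω x / dist x y) 1 ^ γ ≤ 1 :=
    Real.rpow_le_one (by positivity) (min_le_right _ _) hγ
  have hmy : bdist Ω x ^ γ * min (bdist Ω y / dist x y) 1 ^ γ ≤ 2 ^ γ * bdist Ω y ^ γ := by
    rw [← Real.mul_rpow hx0 (by positivity), ← Real.mul_rpow zero_le_two hy0]
    exact Real.rpow_le_rpow (by positivity) (bdist_mul_min_div_le x hd) hγ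
  calc bdist Ω x ^ γ * greenProfile Ω s γ x y
      = dist x y ^ (-((N : ℝ) - 2 * s)) * min (bdist Ω x / dist x y) 1 ^ γ *
          (bdist Ω x ^ γ * min (bdist Ω y / dist x y) 1 ^ γ) := by
        rw [greenProfile, Real.rpow_neg hd.le, one_div]; ring
    _ ≤ dist x y ^ (-((N : ℝ) - 2 * s)) * 1 * (2 ^ γ * bdist Ω y ^ γ) := by gcongr
    _ = 2 ^ γ * bdist Ω y ^ γ * dist x y ^ (-((N : ℝ) - 2 * s)) := by ring

theorem IsGreenKernel.exists_bdist_rpow_mul_abs_le (hG : IsGreenKernel Ω s γ G) (hγ : 0 ≤ γ) :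
    ∃ c ≥ 0, ∀ x ∈ Ω, ∀ y ∈ Ω, x ≠ y →
      bdist Ω x ^ γ * |G x y| ≤ c * bdist Ω y ^ γ * dist x y ^ (-((N : ℝ) - 2 * s)) := by
  obtain ⟨_, _, c₂, hc₂, hest⟩ := hG.estimate
  refine ⟨c₂ * 2 ^ γ, by positivity, fun x hx y hy hxy => ?_⟩
  rw [abs_of_pos (hG.pos x hx y hy hxy)]
  calc bdist Ω x ^ γ * G x y ≤ bdist Ω x ^ γ * (c₂ * greenProfile Ω s γ x y) :=
        mul_le_mul_of_nonneg_left (hest x hx y hy hxy).2 (bdist_rpow_nonneg Ω γ x)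
    _ = c₂ * (bdist Ω x ^ γ * greenProfile Ω s γ x y) := by ring
    _ ≤ c₂ * (2 ^ γ * bdist Ω y ^ γ * dist x y ^ (-((N : ℝ) - 2 * s))) :=
        mul_le_mul_of_nonneg_left (bdist_rpow_mul_greenProfile_le hγ hxy) hc₂.le
    _ = c₂ * 2 ^ γ * bdist Ω y ^ γ * dist x y ^ (-((N : ℝ) - 2 * s)) := by ring

theorem continuousOn_sdiff_singleton_of_offDiag {X Y : Type*} [TopologicalSpace X]
    [TopologicalSpace Y] {A : Set X} {F : X → X → Y}
    (hF : ContinuousOn (Function.uncurry F) A.offDiag) {x : X} (hx : x ∈ A) :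
    ContinuousOn (F x) (A \ {x}) :=
  hF.comp (f := fun y => (x, y)) (by fun_prop) fun _ hy => ⟨hx, hy.1, fun h => hy.2 h.symm⟩

theorem HasContinuousMartinKernel.exists_tendsto_right (hG : HasContinuousMartinKernel Ω γ G)
    {x z : Space N} (hx : x ∈ Ω) (hz : z ∈ frontier Ω) :
    ∃ b, Tendsto (fun y => G x y / bdist Ω y ^ γ) (𝓝[Ω] z) (𝓝 b) := by
  obtain ⟨M, hM, -⟩ := hG
  have hpair : Tendsto (fun y => (x, y)) (𝓝[Ω] z) (𝓝[Ω ×ˢ Ω] (x, z)) :=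
    (Continuous.prodMk_right x).continuousWithinAt.tendsto_nhdsWithin fun _ hy => ⟨hx, hy⟩
  exact ⟨M x z, (hM x hx z hz).2.comp hpair⟩

end GreenKernel

end GreenStability

open GreenStability SignedRadonMeasure in
theorem corollary4p3_general {N : ℕ} {a γ c : ℝ} (ha : 0 ≤ a) (haN : a < N) (hc : 0 ≤ c)
    {Ω : Set (Space N)} (ho : IsOpen Ω) (hb : Bornology.IsBounded Ω)
    {G : Space N → Space N → ℝ} (hGm : Measurable (Ω.offDiag.domRestrict (Function.uncurry G)))
    (hG : ∀ x ∈ Ω, ∀ y ∈ Ω, x ≠ y →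
      bdist Ω x ^ γ * |G x y| ≤ c * bdist Ω y ^ γ * dist x y ^ (-a))
    (hcont : ∀ x ∈ Ω, ContinuousOn (G x) (Ω \ {x}))
    (hlim : ∀ x ∈ Ω, ∀ z ∈ frontier Ω,
      ∃ b, Tendsto (fun y => G x y / bdist Ω y ^ γ) (𝓝[Ω] z) (𝓝 b))
    {μ : ℕ → SignedRadonMeasure Ω} {μlim : SignedRadonMeasure Ω}
    (hμ : ∀ n, (μ n).MemWeighted γ) (hμlim : μlim.MemWeighted γ)
    (hconv : WeaklyConverges γ μ μlim) :
    (∀ n, GreenMemL1 γ G (μ n)) ∧ GreenMemL1 γ G μlim ∧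
      Tendsto (fun n => eLpNorm (fun x => greenMeas G (μ n) x - greenMeas G μlim x) 1
        (weightedVolume Ω γ)) atTop (𝓝 0) := by
  have : NeZero N := ⟨by rintro rfl; exact (ha.trans_lt haN).ne' Nat.cast_zero⟩
  have hne : Ωᶜ.Nonempty := nonempty_compl.2 fun h =>
    NormedSpace.unbounded_univ ℝ (Space N) (h ▸ hb)
  have : IsFiniteMeasure (volume.restrict Ω) := isFiniteMeasure_restrict.2 hb.measure_lt_top.ne
  have had : a < Module.finrank ℝ (Space N) := by rwa [finrank_euclideanSpace_fin]
  have hKm : Measurable (Function.uncurry (weightedKernel Ω (bdist Ω · ^ γ) G)) :=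
    measurable_weightedKernel ho.measurableSet (measurable_bdist_rpow Ω γ) hGm
  have hK := abs_weightedKernel_le hc (fun _ => bdist_rpow_pos ho hne γ) hG
  have hvol : volume.restrict Ω ≤ (volume : Measure (Space N)) := Measure.restrict_le_self
  obtain ⟨M, hMt, hM⟩ := exists_lintegral_enorm_le hvol ha had hc hK
  refine ⟨fun n => greenMemL1_of_lintegral_le ho hne hKm hMt hM (hμ n),
    greenMemL1_of_lintegral_le ho hne hKm hMt hM hμlim, ?_⟩
  have := fun n => (hμ n).isFiniteMeasure_weightedPos
  have := fun n => (hμ n).isFiniteMeasure_weightedNeg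
  have := hμlim.isFiniteMeasure_weightedPos
  have := hμlim.isFiniteMeasure_weightedNeg
  obtain ⟨C, hCt, hC⟩ := exists_weighted_univ_le hμ hconv
  simp only [fun n => eLpNorm_greenMeas_sub_eq ho hne hKm hMt hM (hμ n) hμlim]
  refine tendsto_lintegral_signedIntegral_of_diagCutoff hvol ha had hc hKm hK
    (C := C + (weightedPos γ μlim + weightedNeg γ μlim) univ)
    (ENNReal.add_ne_top.2 ⟨hCt, measure_ne_top _ _⟩) (fun n => ?_) fun r hr => ?_
  · calc _ = (weightedPos γ (μ n) + weightedNeg γ (μ n)) univ +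
          (weightedPos γ μlim + weightedNeg γ μlim) univ := by
          simp only [Measure.add_apply]; ring
      _ ≤ _ := by gcongr; exact hC n
  · filter_upwards [ae_restrict_mem ho.measurableSet] with x hx
    exact tendsto_signedIntegral_diagCutoff ho hne hKm hr (abs_diagCutoff_le ha hr hK hc) hx
      (hcont x hx) (hlim x hx) hμ hμlim hconv

theorem corollary4p3 {N : ℕ} (s γ : ℝ) (hs : 0 < s ∧ s ≤ 1) (hγ : 0 < γ ∧ γ ≤ 1)
    (hN : 2 * s < (N : ℝ))
    (Ω : Set (GreenStability.Space N)) (hΩ : GreenStability.IsBoundedC2Domain Ω)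
    (L : Lp ℝ 2 (volume.restrict Ω) →ₗ.[ℝ] Lp ℝ 2 (volume.restrict Ω))
    (G : GreenStability.Space N → GreenStability.Space N → ℝ)
    (hG1 : GreenStability.IsGreenOperatorOf Ω L G)
    (hG2 : GreenStability.IsGreenKernel Ω s γ G)
    (hG3 : ContinuousOn (Function.uncurry G) Ω.offDiag)
    (hG4 : GreenStability.HasContinuousMartinKernel Ω γ G)
    (μ : ℕ → GreenStability.SignedRadonMeasure Ω) (μlim : GreenStability.SignedRadonMeasure Ω)
    (hμ : ∀ n, (μ n).MemWeighted γ) (hμlim : μlim.MemWeighted γ)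
    (hconv : GreenStability.WeaklyConverges γ μ μlim) :
    (∀ n, GreenStability.GreenMemL1 γ G (μ n)) ∧ GreenStability.GreenMemL1 γ G μlim ∧
      Tendsto
        (fun n => eLpNorm (fun x => GreenStability.greenMeas G (μ n) x -
          GreenStability.greenMeas G μlim x) 1 (GreenStability.weightedVolume Ω γ))
        atTop (𝓝 0) := by
  obtain ⟨c, hc, hG⟩ := hG2.exists_bdist_rpow_mul_abs_le hγ.1.le
  exact corollary4p3_general (sub_nonneg.2 hN.le) (sub_lt_self _ (by linarith)) hc
    hΩ.isOpen hΩ.isBounded hG2.measurable hG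
    (fun _ => GreenStability.continuousOn_sdiff_singleton_of_offDiag hG3)
    (fun _ hx _ => hG4.exists_tendsto_right hx) hμ hμlim hconv
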